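/- **Setting.** Let $(\mathcal X,\mathscr X)$ be a measurable space, $Q$ a Markov kernel on it and $Q_0$ a probability measure that is stationary for $Q$. Write $Q_0\otimes Q$ for the joint law of $(X_t,X_{t+1})$. Let $u:\mathcal X^2\to\mathbb R$ be the one-period growth of period utility along the optimal plan, $u(X_t,X_{t+1})=U(C^*_{t+1},X_{t+1})-U(C^*_t,X_t)$; the period utility $U$ enters below only through $u$. For $r\ge 1$ let $\phi_r(x)=e^{x^r}-1$. For a probability measure $\mu$ let $E^{\phi_r}(\mu)$ be the set of measurable real functions $f$ with $\int\phi_r(|f|/c)\,d\mu<\infty$ for every $c>0$, where $\mu$-a.e. equal functions are identified. For a Markov kernel $P$ on $\mathcal X$, $\beta\in(0,1)$ and $\theta>0$, put $\alpha=-\frac{1}{\theta(1-\beta)}$. Fix $r>1$. A *continuation value* of $(P,U,\beta,\theta)$ is a function $v\in E^{\phi_r}(Q_0)$ that solves $$v(x)=\beta\log\int e^{v(x')+\alpha u(x,x')}\,P(dx'|x)\qquad\text{for }Q_0\text{-a.e. }x$$ (with finite integral) and that is the unique solution, up to $Q_0$-null sets, in $E^{\phi_s}(Q_0)$ for each $1<s\le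 r$. The *worst-case distortion* and the *worst-case model* are $$m_v(x,x')=\frac{e^{v(x')+\alpha u(x,x')}}{\int e^{v(z)+\alpha u(x,z)}\,P(dz|x)},\qquad P^*(dx'|x)=m_v(x,x')\,P(dx'|x).$$ Let $Y_{t+1}$ be an auxiliary variable with values in a measurable space, with conditional law $\kappa(\cdot|X_t,X_{t+1})$ given $(X_t,X_{t+1})$, and let $\boldsymbol g(x,x',y)\in\mathbb R^{d}$ be measurable. The *moment restriction* holds under $(P,U,\beta,\theta)$ if the tuple has a continuation value $v$ and, for $Q_0$-a.e. $x$, $$\iint \big(m_v(x,x')\,\beta\,\boldsymbol g(x,x',y)-\boldsymbol 1\big)\,\kappa(dy|x,x')\,P(dx'|x)=\boldsymbol 0,$$ the function $m_v(x,\cdot)\,\beta\,\boldsymbol g(x,\cdot,\cdot)$ being integrable. Two tuples are *observationally equivalent* with respect to $(\kappa,\boldsymbol g)$ if the moment restriction holds under both. **Proposition 3.3.** Let Assumption U hold: $u\in E^{\phi_r}(Q_0\otimes Q)$ for some $r>1$, and fix this $r$. Let $\beta_0\in(0,1)$ and $\theta_0>0$. Then for every $\theta>0$ there is a Markov kernel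 $Q_\theta$ on $\mathcal X$ such that: 1. $(Q_\theta,U,\beta_0,\theta)$ and $(Q,U,\beta_0,\theta_0)$ both have a continuation value, and they induce the same worst-case model: $Q_\theta^*(\cdot|x)=Q^*(\cdot|x)$ for $Q_0$-a.e. $x$. 2. For all $\kappa$ and $\boldsymbol g$ as above (in every dimension $d$) for which the moment restriction holds under $(Q,U,\beta_0,\theta_0)$, the tuples $(Q_\theta,U,\beta_0,\theta)$ and $(Q,U,\beta_0,\theta_0)$ are observationally equivalent with respect to $(\kappa,\boldsymbol g)$. Thus the benchmark model and $\theta$ are jointly underidentified. -/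

import Mathlib

open MeasureTheory ProbabilityTheory

noncomputable section

namespace Robust

/-- The Young function `φ_r(x) = exp(x^r) - 1` (used for `x ≥ 0`, `r ≥ 1`). -/
def phi (r x : ℝ) : ℝ := Real.exp (x ^ r) - 1

/-- `f` belongs to the Orlicz heart `E^{φ_r}(μ)`: `f` is measurable and
`E^μ[φ_r(|f|/c)] < ∞` for every `c > 0`.  For a probability measure `μ` this forces the
Luxemburg norm of `f` to be finite, since `E^μ[φ_r(|f|/c)] → 0` as `c → ∞`.  Functions, not
classes, are used; equality in `E^{φ_r}(μ)` is `μ`-almost everywhere equality. -/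
def MemOrliczHeart {S : Type*} [MeasurableSpace S] (r : ℝ) (μ : Measure S) (f : S → ℝ) : Prop :=
  Measurable f ∧ ∀ c : ℝ, 0 < c → Integrable (fun x => phi r (|f x| / c)) μ

/-- The composite parameter `α = -1 / (θ (1 - β))`. -/
def alpha (β θ : ℝ) : ℝ := -(1 / (θ * (1 - β)))

variable {X : Type*} [MeasurableSpace X]

/-- The operator `T f(x) = β log E^Q[exp(f(X_{t+1}) + α u(X_t, X_{t+1})) | X_t = x]`. -/
def opT (Q : Kernel X X) (u : X → X → ℝ) (β θ : ℝ) (f : X → ℝ) (x : X) : ℝ :=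
  β * Real.log (∫ x', Real.exp (f x' + alpha β θ * u x x') ∂(Q x))

/-- `f` solves the continuation value recursion `f = T f`, `Q₀`-almost everywhere; the
conditional expectation in `T f` is required to be finite. -/
def IsFixedPoint (Q₀ : Measure X) (Q : Kernel X X) (u : X → X → ℝ) (β θ : ℝ) (f : X → ℝ) :
    Prop :=
  ∀ᵐ x ∂Q₀, Integrable (fun x' => Real.exp (f x' + alpha β θ * u x x')) (Q x) ∧
    f x = opT Q u β θ f x

/-- `v` is the (scaled) continuation value of `(Q, u, β, θ)`: it lies in `E^{φ_r}(Q₀)`, solves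
the recursion, and is, up to `Q₀`-null sets, the only solution in each `E^{φ_s}(Q₀)`,
`1 < s ≤ r`. -/
structure IsContinuationValue (Q₀ : Measure X) (r : ℝ) (u : X → X → ℝ)
    (Q : Kernel X X) (β θ : ℝ) (v : X → ℝ) : Prop where
  mem : MemOrliczHeart r Q₀ v
  fixed : IsFixedPoint Q₀ Q u β θ v
  unique : ∀ s : ℝ, 1 < s → s ≤ r → ∀ f : X → ℝ,
    MemOrliczHeart s Q₀ f → IsFixedPoint Q₀ Q u β θ f → f =ᵐ[Q₀] v

/-- The worst-case belief distortion
`m_v(x, x') = exp(v(x') + α u(x, x')) / E^Q[exp(v(X_{t+1}) + α u(X_t, X_{t+1})) | X_t = x]`. -/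
def distortion (Q : Kernel X X) (u : X → X → ℝ) (β θ : ℝ) (v : X → ℝ) (x x' : X) : ℝ :=
  Real.exp (v x' + alpha β θ * u x x') /
    ∫ z, Real.exp (v z + alpha β θ * u x z) ∂(Q x)

/-- The worst-case conditional law of `X_{t+1}` given `X_t = x`: the measure
`m_v(x, x') Q(dx' | x)`. -/
def worstCase (Q : Kernel X X) (u : X → X → ℝ) (β θ : ℝ) (v : X → ℝ) (x : X) : Measure X :=
  (Q x).withDensity fun x' => ENNReal.ofReal (distortion Q u β θ v x x')

/-- Both tuples have a continuation value, and their worst-case conditional laws coincide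
for `Q₀`-almost every current state. -/
def SameWorstCase (Q₀ : Measure X) (r : ℝ) (u : X → X → ℝ)
    (Q : Kernel X X) (β θ : ℝ) (Q' : Kernel X X) (β' θ' : ℝ) : Prop :=
  ∃ v v' : X → ℝ, IsContinuationValue Q₀ r u Q β θ v ∧ IsContinuationValue Q₀ r u Q' β' θ' v' ∧
    ∀ᵐ x ∂Q₀, worstCase Q u β θ v x = worstCase Q' u β' θ' v' x

/-- The conditional moment restriction
`E^Q[m*_{t+1} β g(X_t, X_{t+1}, Y_{t+1}) - 1 | X_t] = 0` (a vector of `d` equations), with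
`m*_{t+1}` the distortion built from the continuation value of `(Q, u, β, θ)`.  The kernel `κ` is
the conditional law of `Y_{t+1}` given `(X_t, X_{t+1})`, so that `(Q ⊗ₖ κ) x` is the law of
`(X_{t+1}, Y_{t+1})` given `X_t = x`. -/
def MomentRestriction (Q₀ : Measure X) (r : ℝ) (u : X → X → ℝ)
    {Y : Type*} [MeasurableSpace Y] (κ : Kernel (X × X) Y) {d : ℕ} (g : X × X × Y → Fin d → ℝ)
    (Q : Kernel X X) (β θ : ℝ) : Prop :=
  ∃ v : X → ℝ, IsContinuationValue Q₀ r u Q β θ v ∧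
    ∀ i : Fin d, ∀ᵐ x ∂Q₀,
      Integrable (fun p : X × Y => distortion Q u β θ v x p.1 * β * g (x, p.1, p.2) i)
        ((Q ⊗ₖ κ) x) ∧
      ∫ p : X × Y, (distortion Q u β θ v x p.1 * β * g (x, p.1, p.2) i - 1) ∂((Q ⊗ₖ κ) x) = 0

/-- Observational equivalence of two tuples: the conditional moment restriction holds under
both of them. -/
def ObservationallyEquivalent (Q₀ : Measure X) (r : ℝ) (u : X → X → ℝ)
    {Y : Type*} [MeasurableSpace Y] (κ : Kernel (X × X) Y) {d : ℕ} (g : X × X × Y → Fin d → ℝ)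
    (Q : Kernel X X) (β θ : ℝ) (Q' : Kernel X X) (β' θ' : ℝ) : Prop :=
  MomentRestriction Q₀ r u κ g Q β θ ∧ MomentRestriction Q₀ r u κ g Q' β' θ'

end Robust

end

/-! An exponential tilt of `Q` can absorb a change of `θ`. Let `α₀` and `α` be the coefficients of
`u` at `θ₀` and `θ`, and let `f` solve `f(x) = β₀ log E^Q[exp(f(X_{t+1}) + (α₀ - α) u) | X_t = x]`.
Give `Q_θ` the density `exp(f(x') + (α₀ - α) u(x, x') - f(x) / β₀)` with respect to `Q`; the
equation for `f` says that this has mass one. Multiplied by `exp(g(x') + α u)`, it becomes `exp((g +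
f)(x') + α₀ u)` up to the factor `exp(-f(x) / β₀)`, so `g` solves the recursion for `(Q_θ, θ)` iff
`g + f` solves it for `(Q, θ₀)`. Hence `v - f` is the new continuation value, density times new
distortion is the old distortion, and worst-case laws and moments agree.

What remains is existence and uniqueness for `f = β log E[exp(f + h)]`, with `h` a multiple of `u`
of either sign. With `H = exp(f / β)` this reads `H = E[H^β e^h]`, a monotone equation. Young's
inequality and stationarity give `E H ≤ β E H + (1 - β) E e^{h / (1 - β)}`, and the same after
applying a suitable convex increasing function; as `β < 1`, this yields a priori bounds.

Existence (`exists_solves`): for `|h|` the iterates from `1` increase to a fixed point `H` with all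
moments. For `h` itself, `H⁻¹` is a subsolution and `H` a supersolution, so iteration gives a fixed
point between them.

Uniqueness (`Solves.ae_eq`): if `f` and `g` are solutions, Hölder makes `m f - (m - 1) g` a
subsolution for every `m > 1`, so its exponential moment is bounded uniformly in `m`; letting `m →
∞` forces `f ≤ g`. -/

noncomputable section

namespace Robust

open scoped ENNReal
open Filter

variable {X : Type*} [MeasurableSpace X]

/-! ### Monotone iteration for the transformed operator -/

section tilt

/-- The nonlinear expectation operator `H ↦ E[H(X_{t+1})^β w(X_t, X_{t+1}) | X_t]`, which is the
operator `T` after the change of variable `H = exp (f / β)`. -/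
def tilt (Q : Kernel X X) (β : ℝ) (w : X → X → ℝ≥0∞) (H : X → ℝ≥0∞) (x : X) : ℝ≥0∞ :=
  ∫⁻ x', H x' ^ β * w x x' ∂(Q x)

variable {Q : Kernel X X} {β : ℝ} {w w' : X → X → ℝ≥0∞} {G H : X → ℝ≥0∞}

lemma measurable_tilt [IsSFiniteKernel Q] (hw : Measurable (Function.uncurry w))
    (hH : Measurable H) : Measurable (tilt Q β w H) := by
  have : Measurable (Function.uncurry fun x x' => H x' ^ β * w x x') :=
    ((hH.comp measurable_snd).pow_const β).mul hw
  exact this.lintegral_kernel_prod_right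

lemma tilt_mono (hβ : 0 ≤ β) (hw : ∀ x x', w x x' ≤ w' x x') (h : G ≤ H) :
    tilt Q β w G ≤ tilt Q β w' H := fun x =>
  lintegral_mono fun x' => mul_le_mul' (ENNReal.rpow_le_rpow (h x') hβ) (hw x x')

lemma iSup_rpow {ι : Sort*} (f : ι → ℝ≥0∞) {p : ℝ} (hp : 0 < p) :
    (⨆ i, f i) ^ p = ⨆ i, f i ^ p :=
  (ENNReal.orderIsoRpow p hp).map_iSup f

lemma tilt_iSup (hβ : 0 < β) (hw : Measurable (Function.uncurry w))
    {F : ℕ → X → ℝ≥0∞} (hF : ∀ n, Measurable (F n)) (hmono : Monotone F) :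
    tilt Q β w (⨆ n, F n) = ⨆ n, tilt Q β w (F n) := by
  ext x
  simp only [tilt, iSup_apply]
  rw [← lintegral_iSup]
  · congr 1 with x'
    rw [iSup_rpow _ hβ, ENNReal.iSup_mul]
  · exact fun n => ((hF n).pow_const β).mul hw.of_uncurry_left
  · exact fun m n hmn x' => mul_le_mul' (ENNReal.rpow_le_rpow (hmono hmn x') hβ.le) le_rfl

/-- The iterates of `tilt` started at a subsolution increase to a fixed point. -/
lemma tilt_iterate [IsSFiniteKernel Q] (hβ : 0 < β) (hw : Measurable (Function.uncurry w))
    (hG : Measurable G) (h : G ≤ tilt Q β w G) :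
    (∀ n, Measurable ((tilt Q β w)^[n] G)) ∧ Measurable (⨆ n, (tilt Q β w)^[n] G) ∧
      (Monotone fun n => (tilt Q β w)^[n] G) ∧
      tilt Q β w (⨆ n, (tilt Q β w)^[n] G) = ⨆ n, (tilt Q β w)^[n] G := by
  have hT : Monotone (tilt Q β w) := fun _ _ h => tilt_mono hβ.le (fun _ _ => le_rfl) h
  have hmeas : ∀ n, Measurable ((tilt Q β w)^[n] G) := by
    intro n
    induction n with
    | zero => exact hG
    | succ n ih => rw [Function.iterate_succ_apply']; exact measurable_tilt hw ih
  have hmono : Monotone fun n => (tilt Q β w)^[n] G := hT.monotone_iterate_of_le_map h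
  refine ⟨hmeas, ?_, hmono, ?_⟩
  · simpa only [← iSup_apply] using Measurable.iSup hmeas
  rw [tilt_iSup hβ hw hmeas hmono]
  simp_rw [← Function.iterate_succ_apply']
  exact hmono.iSup_nat_add 1

lemma tilt_iterate_le (hβ : 0 < β) (hGH : G ≤ H) (hH : tilt Q β w H ≤ H) (n : ℕ) :
    (tilt Q β w)^[n] G ≤ H := by
  induction n with
  | zero => exact hGH
  | succ n ih =>
    rw [Function.iterate_succ_apply']
    exact (tilt_mono hβ.le (fun _ _ => le_rfl) ih).trans hH

/-- Young's inequality with exponents `1 / β` and `1 / (1 - β)`. The coefficient `β < 1` of `a` is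
what closes all moment estimates. -/
lemma rpow_mul_le_weighted (a b : ℝ≥0∞) (hβ₀ : 0 < β) (hβ₁ : β < 1) :
    a ^ β * b ≤ ENNReal.ofReal β * a + ENNReal.ofReal (1 - β) * b ^ (1 / (1 - β)) := by
  have hpq : (1 / β).HolderConjugate (1 / (1 - β)) := by
    rw [Real.holderConjugate_iff]
    exact ⟨by rw [lt_div_iff₀ hβ₀]; linarith, by simp⟩
  have h := ENNReal.young_inequality (a ^ β) b hpq
  rw [← ENNReal.rpow_mul, mul_one_div_cancel hβ₀.ne', ENNReal.rpow_one, one_div,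
    ENNReal.ofReal_inv_of_pos hβ₀, div_eq_mul_inv, inv_inv, mul_comm a, one_div,
    ENNReal.ofReal_inv_of_pos (sub_pos.2 hβ₁), div_eq_mul_inv, inv_inv, mul_comm (b ^ _)] at h
  simpa using h

end tilt

/-! ### A convex substitute for `exp (k (log x) ^ r)` -/

section expPow

/-- A supremum of multiples of powers with exponents at least one that agrees with
`exp (k (log x) ^ r)` for large `x`: the exponents of `e ^ t` are the affine minorants of
`k t ^ r` with slope at least one, indexed by the point of tangency. -/
def expPow (k r : ℝ) (x : ℝ≥0∞) : ℝ≥0∞ :=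
  ⨆ s : {s : ℝ // 0 < s ∧ 1 ≤ k * r * s ^ (r - 1)},
    ENNReal.ofReal (Real.exp (-(k * (r - 1) * (s : ℝ) ^ r))) * x ^ (k * r * (s : ℝ) ^ (r - 1))

variable {k r : ℝ}

lemma measurable_expPow : Measurable (expPow k r) := by
  refine LowerSemicontinuous.measurable (lowerSemicontinuous_iSup fun s => ?_)
  exact (ENNReal.continuous_const_mul ENNReal.ofReal_ne_top).comp
    ENNReal.continuous_rpow_const |>.lowerSemicontinuous

lemma expPow_mono : Monotone (expPow k r) := fun _ _ h =>
  iSup_mono fun s => mul_le_mul' le_rfl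
    (ENNReal.rpow_le_rpow h (zero_le_one.trans s.2.2))

lemma expPow_iSup {ι : Sort*} (f : ι → ℝ≥0∞) : expPow k r (⨆ i, f i) = ⨆ i, expPow k r (f i) := by
  simp only [expPow]
  rw [iSup_comm]
  congr 1 with s
  rw [iSup_rpow _ (zero_lt_one.trans_le s.2.2), ENNReal.mul_iSup]

/-- Powers with exponent at least one are convex, and suprema preserve convexity; this is why
smaller slopes are excluded from the index set. -/
lemma expPow_add_le {a b : ℝ≥0∞} (hab : a + b = 1) (x y : ℝ≥0∞) :
    expPow k r (a * x + b * y) ≤ a * expPow k r x + b * expPow k r y := by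
  refine iSup_le fun s => ?_
  calc _ ≤ ENNReal.ofReal (Real.exp (-(k * (r - 1) * (s : ℝ) ^ r))) *
        (a * x ^ (k * r * (s : ℝ) ^ (r - 1)) + b * y ^ (k * r * (s : ℝ) ^ (r - 1))) := by
        gcongr
        exact ENNReal.rpow_arith_mean_le_arith_mean2_rpow a b x y hab s.2.2
    _ = a * (ENNReal.ofReal (Real.exp (-(k * (r - 1) * (s : ℝ) ^ r))) *
          x ^ (k * r * (s : ℝ) ^ (r - 1))) +
        b * (ENNReal.ofReal (Real.exp (-(k * (r - 1) * (s : ℝ) ^ r))) *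
          y ^ (k * r * (s : ℝ) ^ (r - 1))) := by ring
    _ ≤ _ := by
      gcongr
      · exact le_iSup (fun s : {s : ℝ // 0 < s ∧ 1 ≤ k * r * s ^ (r - 1)} =>
          ENNReal.ofReal (Real.exp (-(k * (r - 1) * (s : ℝ) ^ r))) *
            x ^ (k * r * (s : ℝ) ^ (r - 1))) s
      · exact le_iSup (fun s : {s : ℝ // 0 < s ∧ 1 ≤ k * r * s ^ (r - 1)} =>
          ENNReal.ofReal (Real.exp (-(k * (r - 1) * (s : ℝ) ^ r))) *
            y ^ (k * r * (s : ℝ) ^ (r - 1))) s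

lemma lintegral_rpow_le {S : Type*} [MeasurableSpace S] (μ : Measure S) [IsProbabilityMeasure μ]
    {f : S → ℝ≥0∞} (hf : AEMeasurable f μ) {p : ℝ} (hp : 1 ≤ p) :
    (∫⁻ x, f x ∂μ) ^ p ≤ ∫⁻ x, f x ^ p ∂μ := by
  have hp0 : 0 < p := zero_lt_one.trans_le hp
  have h := eLpNorm'_le_eLpNorm'_of_exponent_le zero_lt_one hp μ hf.aestronglyMeasurable
  simp only [eLpNorm', enorm_eq_self, ENNReal.rpow_one, div_one] at h
  have h2 := ENNReal.rpow_le_rpow h hp0.le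
  rwa [← ENNReal.rpow_mul, one_div_mul_cancel hp0.ne', ENNReal.rpow_one] at h2

lemma expPow_lintegral_le {S : Type*} [MeasurableSpace S] (μ : Measure S)
    [IsProbabilityMeasure μ] {f : S → ℝ≥0∞} (hf : Measurable f) :
    expPow k r (∫⁻ x, f x ∂μ) ≤ ∫⁻ x, expPow k r (f x) ∂μ := by
  refine iSup_le fun s => ?_
  calc _ ≤ ENNReal.ofReal (Real.exp (-(k * (r - 1) * (s : ℝ) ^ r))) *
        ∫⁻ x, f x ^ (k * r * (s : ℝ) ^ (r - 1)) ∂μ := by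
        gcongr
        exact lintegral_rpow_le μ hf.aemeasurable s.2.2
    _ = ∫⁻ x, ENNReal.ofReal (Real.exp (-(k * (r - 1) * (s : ℝ) ^ r))) *
        f x ^ (k * r * (s : ℝ) ^ (r - 1)) ∂μ := by
        rw [lintegral_const_mul' _ _ ENNReal.ofReal_ne_top]
    _ ≤ _ := lintegral_mono fun x =>
        le_iSup (fun s : {s : ℝ // 0 < s ∧ 1 ≤ k * r * s ^ (r - 1)} =>
          ENNReal.ofReal (Real.exp (-(k * (r - 1) * (s : ℝ) ^ r))) *
            f x ^ (k * r * (s : ℝ) ^ (r - 1))) s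

lemma ofReal_exp_rpow (t p : ℝ) :
    ENNReal.ofReal (Real.exp t) ^ p = ENNReal.ofReal (Real.exp (t * p)) := by
  rw [ENNReal.ofReal_rpow_of_pos (Real.exp_pos t), ← Real.exp_mul]

lemma tangent_le_rpow (hr : 1 ≤ r) {s t : ℝ} (hs : 0 < s) (ht : 0 ≤ t) :
    r * s ^ (r - 1) * t - (r - 1) * s ^ r ≤ t ^ r := by
  have h := one_add_mul_self_le_rpow_one_add (s := t / s - 1) (by
    have := div_nonneg ht hs.le
    linarith) hr
  rw [add_sub_cancel, Real.div_rpow ht hs.le, le_div_iff₀ (by positivity)] at h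
  have h2 : s ^ r = s ^ (r - 1) * s := by
    rw [← Real.rpow_add_one hs.ne', sub_add_cancel]
  calc _ = (1 + r * (t / s - 1)) * s ^ r := by
        rw [h2]; field_simp; ring
    _ ≤ _ := h

lemma expPow_ofReal_exp_le (hk : 0 ≤ k) (hr : 1 ≤ r) {t : ℝ} (ht : 0 ≤ t) :
    expPow k r (ENNReal.ofReal (Real.exp t)) ≤ ENNReal.ofReal (Real.exp (k * t ^ r)) := by
  refine iSup_le fun s => ?_
  rw [ofReal_exp_rpow, ← ENNReal.ofReal_mul (Real.exp_pos _).le, ← Real.exp_add]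
  gcongr
  have := mul_le_mul_of_nonneg_left (tangent_le_rpow hr s.2.1 ht) hk
  linarith

/-- The tangent at `s = t` is exact, and it is admissible once `k r t ^ (r - 1) ≥ 1`. Below that
threshold the left side is at most its value there, the added constant. -/
lemma le_expPow_ofReal_exp (hk : 0 < k) (hr : 1 < r) {t : ℝ} (ht : 0 ≤ t) :
    ENNReal.ofReal (Real.exp (k * t ^ r)) ≤ expPow k r (ENNReal.ofReal (Real.exp t)) +
      ENNReal.ofReal (Real.exp (k * ((k * r)⁻¹ ^ (r - 1)⁻¹) ^ r)) := by
  have hr1 : 0 < r - 1 := sub_pos.2 hr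
  have hkr : 0 < k * r := by positivity
  rcases le_total ((k * r)⁻¹ ^ (r - 1)⁻¹) t with h | h
  · refine le_add_right ?_
    have hs0 : 0 < (k * r)⁻¹ ^ (r - 1)⁻¹ := by positivity
    have ht0 : 0 < t := hs0.trans_le h
    have h1 : 1 ≤ k * r * t ^ (r - 1) := by
      have := Real.rpow_le_rpow hs0.le h hr1.le
      rw [← Real.rpow_mul (by positivity), inv_mul_cancel₀ hr1.ne', Real.rpow_one] at this
      calc (1 : ℝ) = k * r * (k * r)⁻¹ := by field_simp
        _ ≤ _ := by gcongr
    refine le_trans (le_of_eq ?_) (le_iSup (fun s : {s : ℝ // 0 < s ∧ 1 ≤ k * r * s ^ (r - 1)} =>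
          ENNReal.ofReal (Real.exp (-(k * (r - 1) * (s : ℝ) ^ r))) *
            ENNReal.ofReal (Real.exp t) ^ (k * r * (s : ℝ) ^ (r - 1))) ⟨t, ht0, h1⟩)
    rw [ofReal_exp_rpow, ← ENNReal.ofReal_mul (Real.exp_pos _).le, ← Real.exp_add]
    have h2 : t ^ r = t ^ (r - 1) * t := by
      rw [← Real.rpow_add_one ht0.ne', sub_add_cancel]
    simp only [h2]
    congr 2
    ring
  · refine le_add_left ?_
    gcongr

lemma expPow_top (hk : 0 < k) (hr : 1 < r) : expPow k r ⊤ = ⊤ := by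
  have hr1 : 0 < r - 1 := sub_pos.2 hr
  have hs0 : 0 < (k * r)⁻¹ ^ (r - 1)⁻¹ := by positivity
  have h1 : 1 ≤ k * r * ((k * r)⁻¹ ^ (r - 1)⁻¹) ^ (r - 1) := by
    rw [← Real.rpow_mul (by positivity), inv_mul_cancel₀ hr1.ne', Real.rpow_one]
    exact (mul_inv_cancel₀ (by positivity)).ge
  refine top_le_iff.1 (le_trans (le_of_eq ?_)
    (le_iSup (fun s : {s : ℝ // 0 < s ∧ 1 ≤ k * r * s ^ (r - 1)} =>
          ENNReal.ofReal (Real.exp (-(k * (r - 1) * (s : ℝ) ^ r))) *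
            ⊤ ^ (k * r * (s : ℝ) ^ (r - 1))) ⟨_, hs0, h1⟩))
  rw [ENNReal.top_rpow_of_pos (zero_lt_one.trans_le h1), ENNReal.mul_top]
  simpa using Real.exp_pos _

end expPow

/-! ### Orlicz hearts through exponential moments -/

section orlicz

variable {S : Type*} [MeasurableSpace S] {μ : Measure S} {r s : ℝ} {f g : S → ℝ}

lemma lintegral_exp_ne_top_iff (hf : Measurable f) :
    ∫⁻ x, ENNReal.ofReal (Real.exp (f x)) ∂μ ≠ ⊤ ↔ Integrable (fun x => Real.exp (f x)) μ := by
  have hm : AEStronglyMeasurable (fun x => Real.exp (f x)) μ :=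
    (Real.measurable_exp.comp hf).aestronglyMeasurable
  exact lintegral_ofReal_ne_top_iff_integrable hm (ae_of_all _ fun x => (Real.exp_pos _).le)

/-- Membership in the Orlicz heart as finiteness of all the moments `E exp (k |f| ^ r)`. -/
lemma memOrliczHeart_iff [IsFiniteMeasure μ] (hr : 0 < r) :
    MemOrliczHeart r μ f ↔ Measurable f ∧
      ∀ k : ℝ, 0 < k → ∫⁻ x, ENNReal.ofReal (Real.exp (k * |f x| ^ r)) ∂μ ≠ ⊤ := by
  refine and_congr_right fun hf => ?_
  have key : ∀ c : ℝ, 0 < c → (Integrable (fun x => phi r (|f x| / c)) μ ↔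
      ∫⁻ x, ENNReal.ofReal (Real.exp ((c ^ r)⁻¹ * |f x| ^ r)) ∂μ ≠ ⊤) := by
    intro c hc
    rw [lintegral_exp_ne_top_iff (by fun_prop)]
    have : (fun x => phi r (|f x| / c)) =
        fun x => Real.exp ((c ^ r)⁻¹ * |f x| ^ r) - 1 := by
      ext x
      rw [phi, Real.div_rpow (abs_nonneg _) hc.le, div_eq_inv_mul]
    rw [this]
    exact ⟨fun h => by simpa [Pi.add_def] using h.add (integrable_const (1 : ℝ)),
      fun h => h.sub (integrable_const _)⟩
  constructor
  -- The scale `c = k⁻¹ ^ r⁻¹` is the one with `(c ^ r)⁻¹ = k`.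
  · intro h k hk
    have := (key (k⁻¹ ^ r⁻¹) (by positivity)).1 (h _ (by positivity))
    rwa [← Real.rpow_mul (by positivity), inv_mul_cancel₀ hr.ne', Real.rpow_one, inv_inv] at this
  · intro h c hc
    exact (key c hc).2 (h _ (by positivity))

lemma MemOrliczHeart.mono_ae [IsFiniteMeasure μ] (hr : 0 < r) (hg : MemOrliczHeart r μ g)
    (hf : Measurable f) (h : ∀ᵐ x ∂μ, |f x| ≤ |g x|) : MemOrliczHeart r μ f := by
  rw [memOrliczHeart_iff hr] at hg ⊢
  refine ⟨hf, fun k hk => ne_top_of_le_ne_top (hg.2 k hk) (lintegral_mono_ae ?_)⟩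
  filter_upwards [h] with x hx
  gcongr

lemma MemOrliczHeart.const_mul [IsFiniteMeasure μ] (hr : 0 < r) (hf : MemOrliczHeart r μ f)
    (c : ℝ) : MemOrliczHeart r μ fun x => c * f x := by
  rw [memOrliczHeart_iff hr] at hf ⊢
  refine ⟨hf.1.const_mul c, fun k hk => ?_⟩
  rcases eq_or_ne c 0 with rfl | hc
  · simp [Real.zero_rpow hr.ne']
  · have := hf.2 (k * |c| ^ r) (by positivity)
    simpa only [abs_mul, Real.mul_rpow (abs_nonneg _) (abs_nonneg _), mul_assoc] using this

lemma MemOrliczHeart.neg (hf : MemOrliczHeart r μ f) : MemOrliczHeart r μ fun x => -f x :=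
  ⟨hf.1.neg, fun c hc => by simpa only [abs_neg] using hf.2 c hc⟩

/-- Since `|f + g| ≤ max |2 f| |2 g|`, the exponential for the sum is at most the sum of those for
`2 f` and `2 g`. -/
lemma MemOrliczHeart.add [IsFiniteMeasure μ] (hr : 0 < r) (hf : MemOrliczHeart r μ f)
    (hg : MemOrliczHeart r μ g) : MemOrliczHeart r μ fun x => f x + g x := by
  have hf2 := hf.const_mul hr 2
  have hg2 := hg.const_mul hr 2
  rw [memOrliczHeart_iff hr] at hf2 hg2 ⊢
  refine ⟨hf.1.add hg.1, fun k hk => ne_top_of_le_ne_top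
    (ENNReal.add_ne_top.2 ⟨hf2.2 k hk, hg2.2 k hk⟩) ?_⟩
  have hm := hf2.1
  rw [← lintegral_add_left (by fun_prop)]
  refine lintegral_mono fun x => ?_
  have h := abs_add_le (f x) (g x)
  simp only [abs_mul, abs_two]
  rcases le_total |f x| |g x| with h' | h'
  · refine le_add_left ?_
    gcongr
    linarith
  · refine le_add_right ?_
    gcongr
    linarith

lemma MemOrliczHeart.sub [IsFiniteMeasure μ] (hr : 0 < r) (hf : MemOrliczHeart r μ f)
    (hg : MemOrliczHeart r μ g) : MemOrliczHeart r μ fun x => f x - g x := by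
  simpa only [sub_eq_add_neg] using hf.add hr hg.neg

lemma rpow_le_one_add_rpow {t : ℝ} (ht : 0 ≤ t) (hs : 0 ≤ s) (hsr : s ≤ r) :
    t ^ s ≤ 1 + t ^ r := by
  rcases le_total t 1 with h | h
  · exact (Real.rpow_le_one ht h hs).trans (le_add_of_nonneg_right (Real.rpow_nonneg ht r))
  · exact (Real.rpow_le_rpow_of_exponent_le h hsr).trans (by linarith)

lemma MemOrliczHeart.of_exponent_le [IsFiniteMeasure μ] (hf : MemOrliczHeart r μ f)
    (hs : 0 < s) (hsr : s ≤ r) : MemOrliczHeart s μ f := by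
  rw [memOrliczHeart_iff (hs.trans_le hsr)] at hf
  rw [memOrliczHeart_iff hs]
  refine ⟨hf.1, fun k hk => ne_top_of_le_ne_top
    (ENNReal.mul_ne_top (ENNReal.ofReal_ne_top (r := Real.exp k)) (hf.2 k hk)) ?_⟩
  rw [← lintegral_const_mul' _ _ ENNReal.ofReal_ne_top]
  refine lintegral_mono fun x => ?_
  rw [← ENNReal.ofReal_mul (Real.exp_pos _).le, ← Real.exp_add]
  gcongr
  have := mul_le_mul_of_nonneg_left (rpow_le_one_add_rpow (abs_nonneg (f x)) hs.le hsr) hk.le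
  linarith

/-- Functions in the Orlicz heart have finite exponential moments. -/
lemma MemOrliczHeart.lintegral_exp_ne_top [IsFiniteMeasure μ] (hf : MemOrliczHeart r μ f)
    (hr : 1 ≤ r) : ∫⁻ x, ENNReal.ofReal (Real.exp (f x)) ∂μ ≠ ⊤ := by
  have h := (memOrliczHeart_iff zero_lt_one).1 (hf.of_exponent_le zero_lt_one hr)
  refine ne_top_of_le_ne_top (h.2 1 one_pos) (lintegral_mono fun x => ?_)
  simp only [Real.rpow_one, one_mul]
  gcongr
  exact le_abs_self _

end orlicz

/-- Cauchy–Schwarz applied to `1 = g ^ (1/2) * g⁻¹ ^ (1/2)`, valid almost everywhere once both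
integrals are finite. -/
lemma inv_lintegral_le {S : Type*} [MeasurableSpace S] (μ : Measure S) [IsProbabilityMeasure μ]
    {g : S → ℝ≥0∞} (hg : Measurable g) : (∫⁻ x, g x ∂μ)⁻¹ ≤ ∫⁻ x, (g x)⁻¹ ∂μ := by
  by_cases h1 : ∫⁻ x, g x ∂μ = ⊤
  · simp [h1]
  by_cases h2 : ∫⁻ x, (g x)⁻¹ ∂μ = ⊤
  · simp [h2]
  have hae : ∀ᵐ x ∂μ, g x ^ (1 / 2 : ℝ) * (g x)⁻¹ ^ (1 / 2 : ℝ) = 1 := by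
    filter_upwards [ae_lt_top hg h1, ae_lt_top hg.inv h2] with x hx hx'
    rw [← ENNReal.mul_rpow_of_nonneg _ _ (by norm_num),
      ENNReal.mul_inv_cancel (by simpa using hx'.ne) hx.ne, ENNReal.one_rpow]
  have h := ENNReal.lintegral_mul_le_Lp_mul_Lq μ Real.HolderConjugate.two_two
    (hg.pow_const (1 / 2 : ℝ)).aemeasurable (hg.inv.pow_const (1 / 2 : ℝ)).aemeasurable
  simp only [Pi.mul_apply, Pi.inv_apply] at h
  rw [lintegral_congr_ae hae] at h
  simp only [← ENNReal.rpow_mul] at h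
  norm_num at h
  rw [← ENNReal.mul_rpow_of_nonneg _ _ (by norm_num)] at h
  have h' := ENNReal.rpow_le_rpow h (z := 2) (by norm_num)
  rw [← ENNReal.rpow_mul] at h'
  norm_num at h'
  exact ENNReal.inv_le_iff_le_mul (fun h => absurd h h2) (fun h => absurd h h1) |>.2 h'

lemma lintegral_lintegral_of_invariant {Q₀ : Measure X} {Q : Kernel X X}
    (hstat : Kernel.Invariant Q Q₀) {f : X → ℝ≥0∞} (hf : Measurable f) :
    ∫⁻ x, ∫⁻ x', f x' ∂(Q x) ∂Q₀ = ∫⁻ x, f x ∂Q₀ := by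
  rw [← Measure.lintegral_bind Q.aemeasurable hf.aemeasurable, hstat.def]

lemma ae_ae_of_invariant {Q₀ : Measure X} {Q : Kernel X X}
    (hstat : Kernel.Invariant Q Q₀) {p : X → Prop} (h : ∀ᵐ x ∂Q₀, p x) :
    ∀ᵐ x ∂Q₀, ∀ᵐ x' ∂(Q x), p x' :=
  Measure.ae_ae_of_ae_comp (κ := Q) (by rwa [hstat.def])

/-! ### A priori bounds from Young's inequality and stationarity -/

section moments

variable {Q₀ : Measure X} {Q : Kernel X X} [IsMarkovKernel Q] {β k r : ℝ}
  {w : X → X → ℝ≥0∞} {H : X → ℝ≥0∞}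

omit [IsMarkovKernel Q] in
lemma tilt_le (hβ₀ : 0 < β) (hβ₁ : β < 1) (x : X) :
    tilt Q β w H x ≤
      ∫⁻ x', (ENNReal.ofReal β * H x' + ENNReal.ofReal (1 - β) * w x x' ^ (1 / (1 - β))) ∂(Q x) :=
  lintegral_mono fun _ => rpow_mul_le_weighted _ _ hβ₀ hβ₁

omit [IsMarkovKernel Q] in
lemma lintegral_tilt_le (hstat : Kernel.Invariant Q Q₀) (hβ₀ : 0 < β) (hβ₁ : β < 1)
    (hH : Measurable H) :
    ∫⁻ x, tilt Q β w H x ∂Q₀ ≤ ENNReal.ofReal β * ∫⁻ x, H x ∂Q₀ +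
      ENNReal.ofReal (1 - β) * ∫⁻ x, ∫⁻ x', w x x' ^ (1 / (1 - β)) ∂(Q x) ∂Q₀ := by
  calc _ ≤ ∫⁻ x, ENNReal.ofReal β * (∫⁻ x', H x' ∂(Q x)) +
        ENNReal.ofReal (1 - β) * ∫⁻ x', w x x' ^ (1 / (1 - β)) ∂(Q x) ∂Q₀ := by
        refine lintegral_mono fun x => (tilt_le hβ₀ hβ₁ x).trans_eq ?_
        rw [lintegral_add_left (hH.const_mul _), lintegral_const_mul' _ _ ENNReal.ofReal_ne_top,
          lintegral_const_mul' _ _ ENNReal.ofReal_ne_top]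
    _ = _ := by
        rw [lintegral_add_left (hH.lintegral_kernel.const_mul _),
          lintegral_const_mul' _ _ ENNReal.ofReal_ne_top,
          lintegral_const_mul' _ _ ENNReal.ofReal_ne_top,
          lintegral_lintegral_of_invariant hstat hH]

lemma ofReal_add_ofReal_one_sub (hβ₀ : 0 < β) (hβ₁ : β < 1) :
    ENNReal.ofReal β + ENNReal.ofReal (1 - β) = 1 := by
  rw [← ENNReal.ofReal_add hβ₀.le (sub_nonneg.2 hβ₁.le)]
  simp

lemma lintegral_expPow_tilt_le (hstat : Kernel.Invariant Q Q₀) (hβ₀ : 0 < β) (hβ₁ : β < 1)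
    (hw : Measurable (Function.uncurry w)) (hH : Measurable H) :
    ∫⁻ x, expPow k r (tilt Q β w H x) ∂Q₀ ≤ ENNReal.ofReal β * ∫⁻ x, expPow k r (H x) ∂Q₀ +
      ENNReal.ofReal (1 - β) *
        ∫⁻ x, ∫⁻ x', expPow k r (w x x' ^ (1 / (1 - β))) ∂(Q x) ∂Q₀ := by
  have hψH : Measurable fun x => expPow k r (H x) := measurable_expPow.comp hH
  calc _ ≤ ∫⁻ x, ENNReal.ofReal β * (∫⁻ x', expPow k r (H x') ∂(Q x)) +
        ENNReal.ofReal (1 - β) * ∫⁻ x', expPow k r (w x x' ^ (1 / (1 - β))) ∂(Q x) ∂Q₀ := by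
        refine lintegral_mono fun x => (expPow_mono (tilt_le hβ₀ hβ₁ x)).trans ?_
        have hwx : Measurable (w x) := hw.of_uncurry_left
        refine (expPow_lintegral_le _ (by fun_prop)).trans ?_
        refine (lintegral_mono fun x' =>
          expPow_add_le (ofReal_add_ofReal_one_sub hβ₀ hβ₁) _ _).trans_eq ?_
        rw [lintegral_add_left (hψH.const_mul _), lintegral_const_mul' _ _ ENNReal.ofReal_ne_top,
          lintegral_const_mul' _ _ ENNReal.ofReal_ne_top]
    _ = _ := by
        rw [lintegral_add_left (hψH.lintegral_kernel.const_mul _),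
          lintegral_const_mul' _ _ ENNReal.ofReal_ne_top,
          lintegral_const_mul' _ _ ENNReal.ofReal_ne_top,
          lintegral_lintegral_of_invariant hstat hψH]

end moments

/-- The weight `exp (h(X_t, X_{t+1}))`. -/
def expWeight (h : X → X → ℝ) (x x' : X) : ℝ≥0∞ := ENNReal.ofReal (Real.exp (h x x'))

lemma measurable_expWeight {h : X → X → ℝ} (hh : Measurable (Function.uncurry h)) :
    Measurable (Function.uncurry (expWeight h)) :=
  (Real.measurable_exp.comp hh).ennreal_ofReal

omit [MeasurableSpace X] in
lemma expWeight_rpow (h : X → X → ℝ) (p : ℝ) (x x' : X) :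
    expWeight h x x' ^ p = ENNReal.ofReal (Real.exp (h x x' * p)) :=
  ofReal_exp_rpow _ _

/-! ### Fixed points of the transformed operator -/

section existence

variable {Q₀ : Measure X} [IsProbabilityMeasure Q₀] {Q : Kernel X X} [IsMarkovKernel Q]
  {β r : ℝ} {h : X → X → ℝ}

lemma lintegral_expPow_expWeight_ne_top (hr : 1 < r)
    (hh : MemOrliczHeart r (Q₀.compProd Q) (fun p : X × X => h p.1 p.2)) {c k : ℝ} (hc : 0 ≤ c)
    (hk : 0 < k) :
    ∫⁻ x, ∫⁻ x', expPow k r (expWeight (fun x x' => |h x x'|) x x' ^ c) ∂(Q x) ∂Q₀ ≠ ⊤ := by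
  have hr0 : 0 < r := zero_lt_one.trans hr
  have h1 := ((memOrliczHeart_iff hr0).1 (hh.const_mul hr0 c)).2 k hk
  have hm := hh.1
  rw [Measure.lintegral_compProd (by fun_prop)] at h1
  refine ne_top_of_le_ne_top h1 (lintegral_mono fun x => lintegral_mono fun x' => ?_)
  rw [expWeight_rpow]
  refine (expPow_ofReal_exp_le hk.le hr.le (by positivity)).trans ?_
  simp only [abs_mul, abs_of_nonneg hc]
  rw [mul_comm |h x x'|]

lemma lintegral_expWeight_rpow_ne_top (hr : 1 ≤ r)
    (hh : MemOrliczHeart r (Q₀.compProd Q) (fun p : X × X => h p.1 p.2)) (c : ℝ) :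
    ∫⁻ x, ∫⁻ x', expWeight h x x' ^ c ∂(Q x) ∂Q₀ ≠ ⊤ := by
  have h1 := (hh.const_mul (zero_lt_one.trans_le hr) c).lintegral_exp_ne_top hr
  have hm := hh.1
  rw [Measure.lintegral_compProd (by fun_prop)] at h1
  simpa only [expWeight_rpow, mul_comm] using h1

/-- A fixed point for the weight `exp |h|` that is at least one and all of whose moments
`exp (k (log H) ^ r)` are finite. -/
lemma exists_tilt_abs_fixed (hstat : Kernel.Invariant Q Q₀) (hβ₀ : 0 < β) (hβ₁ : β < 1)
    (hr : 1 < r) (hmeas : Measurable (Function.uncurry h))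
    (hh : MemOrliczHeart r (Q₀.compProd Q) (fun p : X × X => h p.1 p.2)) :
    ∃ H : X → ℝ≥0∞, Measurable H ∧ 1 ≤ H ∧
      tilt Q β (expWeight fun x x' => |h x x'|) H = H ∧
      ∀ k : ℝ, 0 < k → ∫⁻ x, expPow k r (H x) ∂Q₀ ≠ ⊤ := by
  set w := expWeight fun x x' => |h x x'| with hwdef
  have hw : Measurable (Function.uncurry w) := measurable_expWeight hmeas.abs
  have hsub : (1 : X → ℝ≥0∞) ≤ tilt Q β w 1 := by
    intro x
    calc (1 : ℝ≥0∞) = ∫⁻ _, 1 ∂(Q x) := by simp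
      _ ≤ _ := lintegral_mono fun x' => by
        simp [hwdef, expWeight]
  obtain ⟨hm, hme, hmono, hfix⟩ := tilt_iterate hβ₀ hw measurable_one hsub
  refine ⟨_, hme, le_iSup (fun n => (tilt Q β w)^[n] 1) 0, hfix, fun k hk => ?_⟩
  set M := ∫⁻ x, ∫⁻ x', expPow k r (w x x' ^ (1 / (1 - β))) ∂(Q x) ∂Q₀ with hM
  have hMtop : M ≠ ⊤ :=
    lintegral_expPow_expWeight_ne_top hr hh (one_div_nonneg.2 (sub_nonneg.2 hβ₁.le)) hk
  have hone : expPow k r 1 ≤ 1 := by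
    simpa [Real.zero_rpow (zero_lt_one.trans hr).ne'] using
      expPow_ofReal_exp_le hk.le hr.le le_rfl
  -- The bound `1 + M` covers the start and is self-reproducing: each step gives at most `β (1 + M)
  -- + (1 - β) M`.
  have hbd : ∀ n, ∫⁻ x, expPow k r ((tilt Q β w)^[n] 1 x) ∂Q₀ ≤ 1 + M := by
    intro n
    induction n with
    | zero => simpa using hone.trans le_self_add
    | succ n ih =>
      simp only [Function.iterate_succ_apply']
      refine (lintegral_expPow_tilt_le hstat hβ₀ hβ₁ hw (hm n)).trans ?_
      calc _ ≤ ENNReal.ofReal β * (1 + M) + ENNReal.ofReal (1 - β) * (1 + M) := by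
            gcongr
            exact le_add_self
        _ = 1 + M := by rw [← add_mul, ofReal_add_ofReal_one_sub hβ₀ hβ₁, one_mul]
  refine ne_top_of_le_ne_top (ENNReal.add_ne_top.2 ⟨ENNReal.one_ne_top, hMtop⟩) ?_
  simp only [iSup_apply, expPow_iSup]
  rw [lintegral_iSup (f := fun n x => expPow k r ((tilt Q β w)^[n] 1 x))
    (fun n => measurable_expPow.comp (hm n)) (fun m n hmn x => expPow_mono (hmono hmn x))]
  exact iSup_le hbd

/-- A fixed point for the weight `exp h` that lies between `H⁻¹` and `H`. -/
lemma exists_tilt_fixed (hβ₀ : 0 < β) (hmeas : Measurable (Function.uncurry h))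
    {H : X → ℝ≥0∞} (hHm : Measurable H) (hH1 : 1 ≤ H)
    (hH : tilt Q β (expWeight fun x x' => |h x x'|) H = H) :
    ∃ G : X → ℝ≥0∞, Measurable G ∧ H⁻¹ ≤ G ∧ G ≤ H ∧ tilt Q β (expWeight h) G = G := by
  have hw := measurable_expWeight hmeas
  -- Invert the equation for `H`, apply Jensen to the reciprocal, and use `-|h| ≤ h`.
  have hsub : H⁻¹ ≤ tilt Q β (expWeight h) H⁻¹ := by
    intro x
    have hwx : Measurable (expWeight (fun x x' => |h x x'|) x) :=
      (measurable_expWeight hmeas.abs).of_uncurry_left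
    calc H⁻¹ x = (tilt Q β (expWeight fun x x' => |h x x'|) H x)⁻¹ := by rw [hH]; rfl
      _ ≤ ∫⁻ x', (H x' ^ β * expWeight (fun x x' => |h x x'|) x x')⁻¹ ∂(Q x) :=
        inv_lintegral_le _ ((hHm.pow_const β).mul hwx)
      _ ≤ _ := lintegral_mono fun x' => by
        rw [expWeight, ENNReal.mul_inv (Or.inr ENNReal.ofReal_ne_top)
          (Or.inr (by simpa using Real.exp_pos _)), Pi.inv_apply, ENNReal.inv_rpow]
        gcongr
        rw [expWeight, ← ENNReal.ofReal_inv_of_pos (Real.exp_pos _), ← Real.exp_neg]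
        gcongr
        exact neg_abs_le _
  obtain ⟨-, hme, -, hfix⟩ := tilt_iterate hβ₀ hw hHm.inv hsub
  refine ⟨_, hme, le_iSup (fun n => (tilt Q β (expWeight h))^[n] H⁻¹) 0,
    iSup_le fun n => ?_, hfix⟩
  refine tilt_iterate_le hβ₀ (fun x => ?_) ?_ n
  · exact (ENNReal.inv_le_one.2 (hH1 x)).trans (hH1 x)
  · refine (tilt_mono hβ₀.le (fun x x' => ?_) le_rfl).trans hH.le
    exact ENNReal.ofReal_le_ofReal (Real.exp_le_exp.2 (le_abs_self _))

end existence

/-- Encodes integrability and the logarithmic equation in one extended-valued identity: a finite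
right side forces integrability, and positivity of the integral makes `log` invertible. -/
lemma integrable_exp_and_eq_log_iff {S : Type*} [MeasurableSpace S] {μ : Measure S}
    [IsProbabilityMeasure μ] {φ : S → ℝ} (hφ : Measurable φ) {β c : ℝ} (hβ : 0 < β) :
    (Integrable (fun x => Real.exp (φ x)) μ ∧ c = β * Real.log (∫ x, Real.exp (φ x) ∂μ)) ↔
      ∫⁻ x, ENNReal.ofReal (Real.exp (φ x)) ∂μ = ENNReal.ofReal (Real.exp (c / β)) := by
  constructor
  · rintro ⟨hint, hc⟩
    rw [← ofReal_integral_eq_lintegral_ofReal hint (ae_of_all _ fun x => (Real.exp_pos _).le),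
      hc, mul_div_cancel_left₀ _ hβ.ne', Real.exp_log (integral_exp_pos hint)]
  · intro h
    have hint : Integrable (fun x => Real.exp (φ x)) μ :=
      (lintegral_exp_ne_top_iff hφ).1 (h ▸ ENNReal.ofReal_ne_top)
    rw [← ofReal_integral_eq_lintegral_ofReal hint (ae_of_all _ fun x => (Real.exp_pos _).le),
      ENNReal.ofReal_eq_ofReal_iff (integral_exp_pos hint).le (Real.exp_pos _).le] at h
    exact ⟨hint, by rw [h, Real.log_exp, mul_div_cancel₀ _ hβ.ne']⟩

/-- `f` solves `f(x) = β log E[exp (f(X_{t+1}) + h(X_t, X_{t+1})) | X_t = x]` almost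
everywhere. -/
def Solves (Q₀ : Measure X) (Q : Kernel X X) (β : ℝ) (h : X → X → ℝ) (f : X → ℝ) : Prop :=
  ∀ᵐ x ∂Q₀, Integrable (fun x' => Real.exp (f x' + h x x')) (Q x) ∧
    f x = β * Real.log (∫ x', Real.exp (f x' + h x x') ∂(Q x))

/-- The change of variable `f ↦ exp (f / β)`. -/
def expDiv (β : ℝ) (f : X → ℝ) (x : X) : ℝ≥0∞ := ENNReal.ofReal (Real.exp (f x / β))

lemma measurable_expDiv {β : ℝ} {f : X → ℝ} (hf : Measurable f) : Measurable (expDiv β f) :=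
  (Real.measurable_exp.comp (hf.div_const β)).ennreal_ofReal

/-! ### Uniqueness and existence of solutions -/

section solutions

variable {Q₀ : Measure X} {Q : Kernel X X} [IsMarkovKernel Q] {β r : ℝ} {h : X → X → ℝ}
  {f g : X → ℝ}

omit [IsMarkovKernel Q] in
lemma tilt_expDiv (hβ : 0 < β) (x : X) :
    tilt Q β (expWeight h) (expDiv β f) x =
      ∫⁻ x', ENNReal.ofReal (Real.exp (f x' + h x x')) ∂(Q x) := by
  refine lintegral_congr fun x' => ?_
  rw [expDiv, expWeight, ofReal_exp_rpow, div_mul_cancel₀ _ hβ.ne',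
    ← ENNReal.ofReal_mul (Real.exp_pos _).le, ← Real.exp_add]

lemma solves_iff (hβ : 0 < β) (hmeas : Measurable (Function.uncurry h)) (hf : Measurable f) :
    Solves Q₀ Q β h f ↔
      ∀ᵐ x ∂Q₀, ∫⁻ x', ENNReal.ofReal (Real.exp (f x' + h x x')) ∂(Q x) =
        ENNReal.ofReal (Real.exp (f x / β)) := by
  refine eventually_congr (ae_of_all _ fun x => ?_)
  exact integrable_exp_and_eq_log_iff (hf.add hmeas.of_uncurry_left) hβ

-- From `A ≤ β A + (1 - β) M` one gets `A ≤ M`, because membership in the heart makes `A` finite.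
-- The bound does not depend on `f`.
omit [IsMarkovKernel Q] in
lemma lintegral_expDiv_le [IsProbabilityMeasure Q₀] (hstat : Kernel.Invariant Q Q₀)
    (hβ₀ : 0 < β) (hβ₁ : β < 1) (hr : 1 ≤ r)
    (hf : MemOrliczHeart r Q₀ f)
    (hsub : ∀ᵐ x ∂Q₀, expDiv β f x ≤ tilt Q β (expWeight h) (expDiv β f) x) :
    ∫⁻ x, expDiv β f x ∂Q₀ ≤ ∫⁻ x, ∫⁻ x', expWeight h x x' ^ (1 / (1 - β)) ∂(Q x) ∂Q₀ := by
  set M := ∫⁻ x, ∫⁻ x', expWeight h x x' ^ (1 / (1 - β)) ∂(Q x) ∂Q₀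
  set A := ∫⁻ x, expDiv β f x ∂Q₀ with hA
  have hAtop : A ≠ ⊤ := by
    have := (hf.const_mul (zero_lt_one.trans_le hr) β⁻¹).lintegral_exp_ne_top hr
    simpa only [hA, expDiv, div_eq_inv_mul] using this
  have h1 : A ≤ ENNReal.ofReal β * A + ENNReal.ofReal (1 - β) * M :=
    (lintegral_mono_ae hsub).trans
      (lintegral_tilt_le hstat hβ₀ hβ₁ (measurable_expDiv hf.1))
  have h2 : ENNReal.ofReal β * A + ENNReal.ofReal (1 - β) * A = A := by
    rw [← add_mul, ofReal_add_ofReal_one_sub hβ₀ hβ₁, one_mul]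
  nth_rewrite 1 [← h2] at h1
  rw [ENNReal.add_le_add_iff_left (ENNReal.mul_ne_top ENNReal.ofReal_ne_top hAtop)] at h1
  exact (ENNReal.mul_le_mul_iff_right (by simpa using hβ₁) ENNReal.ofReal_ne_top).1 h1

/-- Extrapolating from one solution through another one gives a subsolution. -/
lemma expDiv_extrapolate_le_tilt (hβ : 0 < β) (hmeas : Measurable (Function.uncurry h))
    (hfm : Measurable f) (hgm : Measurable g)
    (hf : Solves Q₀ Q β h f) (hg : Solves Q₀ Q β h g) {m : ℝ} (hm : 1 < m) :
    ∀ᵐ x ∂Q₀, expDiv β (fun x => m * f x - (m - 1) * g x) x ≤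
      tilt Q β (expWeight h) (expDiv β fun x => m * f x - (m - 1) * g x) x := by
  rw [solves_iff hβ hmeas hfm] at hf
  rw [solves_iff hβ hmeas hgm] at hg
  filter_upwards [hf, hg] with x hfx hgx
  rw [tilt_expDiv hβ]
  have hm0 : 0 < m := zero_lt_one.trans hm
  have hm1 : m - 1 ≠ 0 := (sub_pos.2 hm).ne'
  have hhx : Measurable (h x) := hmeas.of_uncurry_left
  set J := ∫⁻ x', ENNReal.ofReal (Real.exp (m * f x' - (m - 1) * g x' + h x x')) ∂(Q x) with hJ
  -- Hölder with exponents `m` and `m / (m - 1)`, writing `f + h` as the convex combination of `m f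
  -- - (m - 1) g + h` and `g + h` with weights `1 / m` and `(m - 1) / m`.
  have hol := ENNReal.lintegral_mul_le_Lp_mul_Lq (Q x) (Real.HolderConjugate.conjExponent hm)
    (f := fun x' => ENNReal.ofReal (Real.exp ((m * f x' - (m - 1) * g x' + h x x') / m)))
    (g := fun x' => ENNReal.ofReal (Real.exp ((g x' + h x x') * ((m - 1) / m))))
    (by fun_prop) (by fun_prop)
  have e1 : ∫⁻ x', ((fun x' => ENNReal.ofReal
        (Real.exp ((m * f x' - (m - 1) * g x' + h x x') / m))) *
      fun x' => ENNReal.ofReal (Real.exp ((g x' + h x x') * ((m - 1) / m)))) x' ∂(Q x) =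
      ENNReal.ofReal (Real.exp (f x / β)) := by
    rw [← hfx]
    refine lintegral_congr fun x' => ?_
    rw [Pi.mul_apply, ← ENNReal.ofReal_mul (Real.exp_pos _).le, ← Real.exp_add]
    congr 2
    field_simp
    ring
  have hq : Real.conjExponent m = m / (m - 1) := rfl
  rw [e1, hq] at hol
  simp only [ofReal_exp_rpow, div_mul_cancel₀ _ hm0.ne', mul_assoc,
    div_mul_div_cancel₀ hm0.ne', div_self hm1, mul_one] at hol
  rw [← hJ, hgx, one_div_div, ofReal_exp_rpow] at hol
  have h2 := ENNReal.rpow_le_rpow hol hm0.le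
  rw [ENNReal.mul_rpow_of_nonneg _ _ hm0.le, ← ENNReal.rpow_mul, one_div_mul_cancel hm0.ne',
    ENNReal.rpow_one, ofReal_exp_rpow, ofReal_exp_rpow, mul_assoc,
    div_mul_cancel₀ _ hm0.ne'] at h2
  have h3 := mul_le_mul_left h2 (ENNReal.ofReal (Real.exp (-(g x / β * (m - 1)))))
  rw [← ENNReal.ofReal_mul (Real.exp_pos _).le, ← Real.exp_add, mul_assoc,
    ← ENNReal.ofReal_mul (Real.exp_pos _).le, ← Real.exp_add, add_neg_cancel, Real.exp_zero,
    ENNReal.ofReal_one, mul_one] at h3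
  refine le_trans (le_of_eq ?_) h3
  rw [expDiv]
  congr 2
  ring

lemma Solves.ae_le [IsProbabilityMeasure Q₀] (hstat : Kernel.Invariant Q Q₀)
    (hβ₀ : 0 < β) (hβ₁ : β < 1) {s : ℝ} (hs : 1 ≤ s) (hr : 1 ≤ r)
    (hh : MemOrliczHeart r (Q₀.compProd Q) (fun p : X × X => h p.1 p.2))
    (hfs : MemOrliczHeart s Q₀ f) (hgs : MemOrliczHeart s Q₀ g)
    (hf : Solves Q₀ Q β h f) (hg : Solves Q₀ Q β h g) : f ≤ᵐ[Q₀] g := by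
  have hs0 := zero_lt_one.trans_le hs
  -- Extrapolation with `m = n + 2`, so that `m > 1` already at `n = 0`. Where `f > g` this grows
  -- linearly in `n`, against the Fatou bound.
  set G : ℕ → X → ℝ := fun n x => ((n : ℝ) + 2) * f x - ((n : ℝ) + 2 - 1) * g x with hG
  have hGs : ∀ n, MemOrliczHeart s Q₀ (G n) := fun n =>
    (hfs.const_mul hs0 _).sub hs0 (hgs.const_mul hs0 _)
  set M := ∫⁻ x, ∫⁻ x', expWeight h x x' ^ (1 / (1 - β)) ∂(Q x) ∂Q₀ with hM
  have hMtop : M ≠ ⊤ := lintegral_expWeight_rpow_ne_top hr hh _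
  have hbd : ∀ n, ∫⁻ x, expDiv β (G n) x ∂Q₀ ≤ M := fun n =>
    lintegral_expDiv_le hstat hβ₀ hβ₁ hs (hGs n)
      (expDiv_extrapolate_le_tilt hβ₀ hh.1 hfs.1 hgs.1 hf hg (by
        have : (0 : ℝ) ≤ n := n.cast_nonneg
        linarith))
  have hlim : ∫⁻ x, liminf (fun n => expDiv β (G n) x) atTop ∂Q₀ ≤ M := by
    refine (lintegral_liminf_le fun n => measurable_expDiv (hGs n).1).trans ?_
    exact liminf_le_of_le (by isBoundedDefault) fun b hb =>
      let ⟨n, hn⟩ := hb.exists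
      hn.trans (hbd n)
  have hfin := ae_lt_top (Measurable.liminf fun n => measurable_expDiv (hGs n).1)
    (ne_top_of_le_ne_top hMtop hlim)
  filter_upwards [hfin] with x hx
  by_contra! hlt
  refine hx.ne (Tendsto.liminf_eq ?_)
  refine ENNReal.tendsto_ofReal_atTop.comp (Real.tendsto_exp_atTop.comp ?_)
  refine Tendsto.atTop_div_const hβ₀ ?_
  have hGx : (fun n => G n x) = fun n : ℕ => (n : ℝ) * (f x - g x) + (2 * f x - g x) := by
    ext n
    simp only [hG]
    ring
  rw [hGx]
  exact tendsto_atTop_add_const_right _ _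
    (tendsto_natCast_atTop_atTop.atTop_mul_const (sub_pos.2 hlt))

/-- Uniqueness of solutions with finite exponential moments. -/
lemma Solves.ae_eq [IsProbabilityMeasure Q₀] (hstat : Kernel.Invariant Q Q₀)
    (hβ₀ : 0 < β) (hβ₁ : β < 1) {s : ℝ} (hs : 1 ≤ s) (hr : 1 ≤ r)
    (hh : MemOrliczHeart r (Q₀.compProd Q) (fun p : X × X => h p.1 p.2))
    (hfs : MemOrliczHeart s Q₀ f) (hgs : MemOrliczHeart s Q₀ g)
    (hf : Solves Q₀ Q β h f) (hg : Solves Q₀ Q β h g) : f =ᵐ[Q₀] g :=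
  (hf.ae_le hstat hβ₀ hβ₁ hs hr hh hfs hgs hg).antisymm
    (hg.ae_le hstat hβ₀ hβ₁ hs hr hh hgs hfs hf)

/-- Existence of a solution in the Orlicz heart. -/
lemma exists_solves [IsProbabilityMeasure Q₀] (hstat : Kernel.Invariant Q Q₀)
    (hβ₀ : 0 < β) (hβ₁ : β < 1) (hr : 1 < r)
    (hh : MemOrliczHeart r (Q₀.compProd Q) (fun p : X × X => h p.1 p.2)) :
    ∃ f : X → ℝ, MemOrliczHeart r Q₀ f ∧ Solves Q₀ Q β h f := by
  have hr0 : 0 < r := zero_lt_one.trans hr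
  have hmeas : Measurable (Function.uncurry h) := hh.1
  obtain ⟨H, hHm, hH1, hHfix, hHmom⟩ := exists_tilt_abs_fixed hstat hβ₀ hβ₁ hr hmeas hh
  obtain ⟨G, hGm, hGl, hGu, hGfix⟩ := exists_tilt_fixed hβ₀ hmeas hHm hH1 hHfix
  have hHtop : ∀ᵐ x ∂Q₀, H x ≠ ⊤ := by
    filter_upwards [ae_lt_top (measurable_expPow.comp hHm) (hHmom 1 one_pos)] with x hx hxt
    simp [hxt, expPow_top one_pos hr] at hx
  set η : X → ℝ := fun x => Real.log (H x).toReal with hη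
  set f : X → ℝ := fun x => β * Real.log (G x).toReal with hf
  have hfm : Measurable f := (Real.measurable_log.comp hGm.ennreal_toReal).const_mul β
  have hηm : Measurable η := Real.measurable_log.comp hHm.ennreal_toReal
  have hHη : ∀ᵐ x ∂Q₀, 0 ≤ η x ∧ H x = ENNReal.ofReal (Real.exp (η x)) := by
    filter_upwards [hHtop] with x hx
    have h1 : 1 ≤ (H x).toReal := by
      simpa using (ENNReal.toReal_le_toReal ENNReal.one_ne_top hx).2 (hH1 x)
    exact ⟨Real.log_nonneg h1, by
      rw [hη, Real.exp_log (zero_lt_one.trans_le h1), ENNReal.ofReal_toReal hx]⟩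
  have hGf : ∀ᵐ x ∂Q₀, G x = expDiv β f x ∧ |f x| ≤ |β * η x| := by
    filter_upwards [hHη] with x ⟨hx0, hx⟩
    have hG1 : ENNReal.ofReal (Real.exp (-η x)) ≤ G x := by
      rw [Real.exp_neg, ENNReal.ofReal_inv_of_pos (Real.exp_pos _), ← hx]
      exact hGl x
    have hG2 : G x ≤ ENNReal.ofReal (Real.exp (η x)) := hx ▸ hGu x
    have hGtop : G x ≠ ⊤ := ne_top_of_le_ne_top ENNReal.ofReal_ne_top hG2
    have hG1' : Real.exp (-η x) ≤ (G x).toReal := (ENNReal.ofReal_le_iff_le_toReal hGtop).1 hG1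
    have hG2' : (G x).toReal ≤ Real.exp (η x) := ENNReal.toReal_le_of_le_ofReal
      (Real.exp_pos _).le hG2
    have hGpos : 0 < (G x).toReal := (Real.exp_pos _).trans_le hG1'
    refine ⟨?_, ?_⟩
    · rw [expDiv, hf, mul_div_cancel_left₀ _ hβ₀.ne', Real.exp_log hGpos,
        ENNReal.ofReal_toReal hGtop]
    · rw [hf, abs_mul, abs_mul, abs_of_nonneg hx0]
      gcongr
      rw [abs_le]
      exact ⟨(Real.le_log_iff_exp_le hGpos).2 hG1', (Real.log_le_iff_le_exp hGpos).2 hG2'⟩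
  have hηr : MemOrliczHeart r Q₀ η := by
    rw [memOrliczHeart_iff hr0]
    refine ⟨hηm, fun k hk => ?_⟩
    refine ne_top_of_le_ne_top (ENNReal.add_ne_top.2 ⟨hHmom k hk,
      ENNReal.ofReal_ne_top (r := Real.exp (k * ((k * r)⁻¹ ^ (r - 1)⁻¹) ^ r))⟩) ?_
    calc _ ≤ ∫⁻ x, (expPow k r (H x) +
          ENNReal.ofReal (Real.exp (k * ((k * r)⁻¹ ^ (r - 1)⁻¹) ^ r))) ∂Q₀ := by
          refine lintegral_mono_ae ?_
          filter_upwards [hHη] with x ⟨hx0, hx⟩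
          rw [abs_of_nonneg hx0, hx]
          exact le_expPow_ofReal_exp hk hr hx0
      _ = _ := by
          rw [lintegral_add_right _ measurable_const, lintegral_const, measure_univ, mul_one]
  refine ⟨f, (hηr.const_mul hr0 β).mono_ae hr0 hfm (hGf.mono fun x hx => hx.2), ?_⟩
  rw [solves_iff hβ₀ hmeas hfm]
  -- `G = exp (f / β)` holds only almost everywhere; stationarity carries it to the next state
  -- inside the integral.
  filter_upwards [hGf, ae_ae_of_invariant hstat hGf] with x hx hx'
  rw [← tilt_expDiv hβ₀, ← expDiv, ← hx.1]
  conv_rhs => rw [← hGfix]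
  refine lintegral_congr_ae ?_
  filter_upwards [hx'] with x' hxx'
  rw [hxx'.1]

end solutions

/-! ### Exponential change of the benchmark kernel -/

/-- The density `exp (f(x') + h(x, x'))` normalized by its conditional expectation where that is
finite, and `1` elsewhere. -/
def twistDensity (Q : Kernel X X) (h : X → X → ℝ) (f : X → ℝ) (x x' : X) : ℝ≥0∞ :=
  open Classical in
  -- The default `1` keeps the twisted kernel Markov at every state, not just almost every one.
  if ∫⁻ z, ENNReal.ofReal (Real.exp (f z + h x z)) ∂(Q x) = ⊤ then 1
  else ENNReal.ofReal (Real.exp (f x' + h x x')) *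
    (∫⁻ z, ENNReal.ofReal (Real.exp (f z + h x z)) ∂(Q x))⁻¹

/-- The kernel with density `twistDensity` with respect to `Q`. -/
def twist (Q : Kernel X X) [IsSFiniteKernel Q] (h : X → X → ℝ) (f : X → ℝ) : Kernel X X :=
  Q.withDensity (twistDensity Q h f)

section twist

variable {Q₀ : Measure X} {Q : Kernel X X} [IsMarkovKernel Q] {β : ℝ} {h h' : X → X → ℝ}
  {f v : X → ℝ}

omit [IsMarkovKernel Q] in
lemma measurable_twistDensity [IsSFiniteKernel Q] (hmeas : Measurable (Function.uncurry h))
    (hf : Measurable f) : Measurable (Function.uncurry (twistDensity Q h f)) := by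
  have hn : Measurable (Function.uncurry fun x x' =>
      ENNReal.ofReal (Real.exp (f x' + h x x'))) :=
    (Real.measurable_exp.comp ((hf.comp measurable_snd).add hmeas)).ennreal_ofReal
  have hZ : Measurable fun p : X × X =>
      ∫⁻ z, ENNReal.ofReal (Real.exp (f z + h p.1 z)) ∂(Q p.1) :=
    (hn.lintegral_kernel_prod_right (κ := Q)).comp measurable_fst
  exact Measurable.ite (hZ (measurableSet_singleton ⊤)) measurable_const (hn.mul hZ.inv)

lemma isMarkovKernel_twist (hmeas : Measurable (Function.uncurry h)) (hf : Measurable f) :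
    IsMarkovKernel (twist Q h f) := by
  refine ⟨fun x => ⟨?_⟩⟩
  have hhx : Measurable (h x) := hmeas.of_uncurry_left
  rw [twist, Kernel.withDensity_apply' Q (measurable_twistDensity hmeas hf)]
  simp only [twistDensity, Measure.restrict_univ]
  split_ifs with hZ
  · simp
  · rw [lintegral_mul_const _ (by fun_prop), ENNReal.mul_inv_cancel _ hZ]
    rw [Ne, lintegral_eq_zero_iff (by fun_prop)]
    intro h0
    have : ∀ᵐ _ ∂(Q x), False := by
      filter_upwards [h0] with z hz
      simp only [Pi.zero_apply, ENNReal.ofReal_eq_zero] at hz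
      exact absurd hz (Real.exp_pos _).not_ge
    simp at this
    exact IsProbabilityMeasure.ne_zero (Q x) this

lemma twist_apply (hβ : 0 < β) (hmeas : Measurable (Function.uncurry h)) (hfm : Measurable f)
    (hf : Solves Q₀ Q β h f) : ∀ᵐ x ∂Q₀, twist Q h f x =
      (Q x).withDensity fun x' => ENNReal.ofReal (Real.exp (f x' + h x x' - f x / β)) := by
  filter_upwards [(solves_iff hβ hmeas hfm).1 hf] with x hx
  rw [twist, Kernel.withDensity_apply Q (measurable_twistDensity hmeas hfm)]
  congr 1 with x'
  rw [twistDensity, hx, if_neg ENNReal.ofReal_ne_top, ← ENNReal.ofReal_inv_of_pos (Real.exp_pos _),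
    ← Real.exp_neg, ← ENNReal.ofReal_mul (Real.exp_pos _).le, ← Real.exp_add, sub_eq_add_neg]

/-- Solutions for the twisted kernel correspond to solutions for the original one. -/
lemma solves_twist_iff (hβ : 0 < β) (hmeas : Measurable (Function.uncurry h))
    (hmeas' : Measurable (Function.uncurry h')) (hfm : Measurable f) (hvm : Measurable v)
    (hf : Solves Q₀ Q β h f) :
    Solves Q₀ (twist Q h f) β h' v ↔
      Solves Q₀ Q β (fun x x' => h x x' + h' x x') (fun x => v x + f x) := by
  have := isMarkovKernel_twist (Q := Q) hmeas hfm
  rw [solves_iff hβ hmeas' hvm, solves_iff (f := fun x => v x + f x) (h := fun x x' => h x x' + h' x x') hβ (hmeas.add hmeas') (hvm.add hfm)]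
  refine Filter.eventually_congr ?_
  filter_upwards [twist_apply hβ hmeas hfm hf] with x hx
  have hhx : Measurable (h x) := hmeas.of_uncurry_left
  have hhx' : Measurable (h' x) := hmeas'.of_uncurry_left
  rw [hx, lintegral_withDensity_eq_lintegral_mul _ (by fun_prop) (by fun_prop)]
  have e : ∫⁻ x', ENNReal.ofReal (Real.exp (v x' + f x' + (h x x' + h' x x'))) ∂(Q x) =
      ENNReal.ofReal (Real.exp (f x / β)) *
      ∫⁻ x', ((fun x' => ENNReal.ofReal (Real.exp (f x' + h x x' - f x / β))) *
        fun x' => ENNReal.ofReal (Real.exp (v x' + h' x x'))) x' ∂(Q x) := by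
    rw [← lintegral_const_mul' _ _ ENNReal.ofReal_ne_top]
    refine lintegral_congr fun x' => ?_
    rw [Pi.mul_apply, ← ENNReal.ofReal_mul (Real.exp_pos _).le, ← Real.exp_add,
      ← ENNReal.ofReal_mul (Real.exp_pos _).le, ← Real.exp_add]
    congr 2
    ring
  rw [e, add_comm (v x), add_div, Real.exp_add, ENNReal.ofReal_mul (Real.exp_pos _).le,
    ENNReal.mul_right_inj (by simpa using Real.exp_pos _) ENNReal.ofReal_ne_top]

end twist

lemma compProd_withDensity_left {Y : Type*} [MeasurableSpace Y] {Q P : Kernel X X}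
    [IsSFiniteKernel Q] [IsSFiniteKernel P] (κ : Kernel (X × X) Y) [IsSFiniteKernel κ]
    {ρ : X → ℝ≥0∞} (hρ : Measurable ρ) {x : X} (hP : P x = (Q x).withDensity ρ) :
    (P ⊗ₖ κ) x = ((Q ⊗ₖ κ) x).withDensity fun p => ρ p.1 := by
  have hρ' : Measurable fun p : X × Y => ρ p.1 := hρ.comp measurable_fst
  refine Measure.ext_of_lintegral _ fun F hF => ?_
  have hκ : Measurable fun x' => ∫⁻ y, F (x', y) ∂(κ (x, x')) := by
    have : Measurable (Function.uncurry fun (q : X × X) y => F (q.2, y)) := by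
      simp only [Function.uncurry_def]
      fun_prop
    exact (this.lintegral_kernel_prod_right (κ := κ)).comp measurable_prodMk_left
  rw [Kernel.lintegral_compProd _ _ _ hF, hP,
    lintegral_withDensity_eq_lintegral_mul _ hρ hκ,
    lintegral_withDensity_eq_lintegral_mul _ hρ' hF,
    Kernel.lintegral_compProd _ _ _ (hρ'.mul hF)]
  refine lintegral_congr fun x' => ?_
  simp only [Pi.mul_apply]
  rw [lintegral_const_mul _ (by fun_prop)]

/-! ### Transfer of continuation values, worst cases and moments -/

section continuationValue

variable {Q₀ : Measure X} [IsProbabilityMeasure Q₀] {Q : Kernel X X} [IsMarkovKernel Q]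
  {u : X → X → ℝ} {r β θ θ' : ℝ} {f v : X → ℝ}

lemma exists_isContinuationValue (hstat : Kernel.Invariant Q Q₀) (hr : 1 < r)
    (hU : MemOrliczHeart r (Q₀.compProd Q) (fun p : X × X => u p.1 p.2))
    (hβ₀ : 0 < β) (hβ₁ : β < 1) (θ : ℝ) : ∃ v, IsContinuationValue Q₀ r u Q β θ v := by
  have hh : MemOrliczHeart r (Q₀.compProd Q) (fun p : X × X => alpha β θ * u p.1 p.2) :=
    hU.const_mul (zero_lt_one.trans hr) _
  obtain ⟨v, hv, hsol⟩ := exists_solves (h := fun x x' => alpha β θ * u x x') hstat hβ₀ hβ₁ hr hh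
  exact ⟨v, hv, hsol, fun s hs hsr f hf hfsol =>
    Solves.ae_eq (h := fun x x' => alpha β θ * u x x') hstat hβ₀ hβ₁ hs.le hr.le hh hf
      (hv.of_exponent_le (zero_lt_one.trans hs) hsr) hfsol hsol⟩

omit [IsProbabilityMeasure Q₀] in
lemma IsFixedPoint.distortion_eq (hβ : 0 < β) (hv : IsFixedPoint Q₀ Q u β θ v) : ∀ᵐ x ∂Q₀, ∀ x',
      distortion Q u β θ v x x' = Real.exp (v x' + alpha β θ * u x x' - v x / β) := by
  filter_upwards [hv] with x ⟨hint, hx⟩ x'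
  rw [distortion, Real.exp_sub, hx, opT, mul_div_cancel_left₀ _ hβ.ne',
    Real.exp_log (integral_exp_pos hint)]

variable (hβ : 0 < β) (hu : Measurable (Function.uncurry u))
  (hf : MemOrliczHeart r Q₀ f)
  (hfsol : Solves Q₀ Q β (fun x x' => (alpha β θ - alpha β θ') * u x x') f)

include hβ hu hf hfsol

omit [IsProbabilityMeasure Q₀] in
lemma isFixedPoint_twist_iff (hv : Measurable v) :
    IsFixedPoint Q₀ (twist Q (fun x x' => (alpha β θ - alpha β θ') * u x x') f) u β θ' v ↔
      IsFixedPoint Q₀ Q u β θ fun x => v x + f x := by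
  refine (solves_twist_iff hβ (hu.const_mul _) (hu.const_mul (alpha β θ')) hf.1 hv hfsol).trans ?_
  have : (fun x x' => (alpha β θ - alpha β θ') * u x x' + alpha β θ' * u x x') =
      fun x x' => alpha β θ * u x x' := by
    ext x x'
    ring
  rw [this]
  rfl

/-- Translation by `f` preserves each `E^{φ_s}(Q₀)`, `1 < s ≤ r`, and matches the solution sets, so
uniqueness is inherited from `Q`; invariance of `Q₀` under the twisted kernel is not needed. -/
lemma IsContinuationValue.twist (hr : 0 < r) (hv : IsContinuationValue Q₀ r u Q β θ v) :
    IsContinuationValue Q₀ r u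
      (twist Q (fun x x' => (alpha β θ - alpha β θ') * u x x') f) β θ' fun x => v x - f x where
  mem := hv.mem.sub hr hf
  fixed := by
    rw [isFixedPoint_twist_iff (v := fun x => v x - f x) hβ hu hf hfsol (hv.mem.1.sub hf.1)]
    simpa using hv.fixed
  unique s hs hsr g hg hgsol := by
    rw [isFixedPoint_twist_iff hβ hu hf hfsol hg.1] at hgsol
    have hs0 := zero_lt_one.trans hs
    filter_upwards [hv.unique s hs hsr _ (hg.add hs0 (hf.of_exponent_le hs0 hsr)) hgsol]
      with x hx
    linarith

/-- The distortions of the two models differ by the density of the twisted kernel. -/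
lemma IsContinuationValue.density_mul_distortion_twist (hr : 0 < r)
    (hv : IsContinuationValue Q₀ r u Q β θ v) : ∀ᵐ x ∂Q₀, ∀ x',
      Real.exp (f x' + (alpha β θ - alpha β θ') * u x x' - f x / β) *
        distortion (Robust.twist Q (fun x x' => (alpha β θ - alpha β θ') * u x x') f) u β θ'
          (fun x => v x - f x) x x' = distortion Q u β θ v x x' := by
  have := isMarkovKernel_twist (Q := Q)
    (h := fun x x' => (alpha β θ - alpha β θ') * u x x') (hu.const_mul _) hf.1
  filter_upwards [hv.fixed.distortion_eq hβ, (hv.twist hβ hu hf hfsol hr).fixed.distortion_eq hβ]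
    with x hx hx' z
  rw [hx, hx', ← Real.exp_add]
  congr 1
  ring

lemma IsContinuationValue.worstCase_twist (hr : 0 < r)
    (hv : IsContinuationValue Q₀ r u Q β θ v) : ∀ᵐ x ∂Q₀,
      worstCase (Robust.twist Q (fun x x' => (alpha β θ - alpha β θ') * u x x') f) u β θ'
        (fun x => v x - f x) x = worstCase Q u β θ v x := by
  have hvm := hv.mem.1
  have hfm := hf.1
  filter_upwards [hv.density_mul_distortion_twist hβ hu hf hfsol hr,
    twist_apply hβ (h := fun x x' => (alpha β θ - alpha β θ') * u x x') (hu.const_mul _)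
      hf.1 hfsol] with x hx hQx
  have hux : Measurable (u x) := hu.of_uncurry_left
  rw [worstCase, worstCase, hQx, ← withDensity_mul _ (by fun_prop)]
  · congr 1 with z
    rw [Pi.mul_apply, ← ENNReal.ofReal_mul (Real.exp_pos _).le, hx]
  · unfold distortion
    fun_prop

lemma MomentRestriction.twist (hr : 0 < r) {Y : Type*} [MeasurableSpace Y]
    {κ : Kernel (X × X) Y} [IsMarkovKernel κ] {d : ℕ} {g : X × X × Y → Fin d → ℝ}
    (h : MomentRestriction Q₀ r u κ g Q β θ) :
    MomentRestriction Q₀ r u κ g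
      (Robust.twist Q (fun x x' => (alpha β θ - alpha β θ') * u x x') f) β θ' := by
  obtain ⟨v, hv, hmom⟩ := h
  refine ⟨_, hv.twist hβ hu hf hfsol hr, fun i => ?_⟩
  have hfm := hf.1
  have hM := isMarkovKernel_twist (Q := Q)
    (h := fun x x' => (alpha β θ - alpha β θ') * u x x') (hu.const_mul _) hf.1
  filter_upwards [hmom i, hv.density_mul_distortion_twist hβ hu hf hfsol hr,
    twist_apply hβ (h := fun x x' => (alpha β θ - alpha β θ') * u x x') (hu.const_mul _)
      hf.1 hfsol] with x ⟨hint, h0⟩ hx hQx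
  have hux : Measurable (u x) := hu.of_uncurry_left
  set ρ : X → ℝ≥0∞ := fun x' =>
    ENNReal.ofReal (Real.exp (f x' + (alpha β θ - alpha β θ') * u x x' - f x / β)) with hρ
  have hρm : Measurable ρ := by fun_prop
  have hρm' : Measurable fun p : X × Y => ρ p.1 := hρm.comp measurable_fst
  have hc := compProd_withDensity_left κ hρm hQx
  have hρtop : ∀ᵐ p ∂((Q ⊗ₖ κ) x), ρ p.1 < ⊤ := ae_of_all _ fun _ => ENNReal.ofReal_lt_top
  have heq : ∀ p : X × Y, (ρ p.1).toReal •
      (distortion (Robust.twist Q (fun x x' => (alpha β θ - alpha β θ') * u x x') f) u β θ'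
        (fun x => v x - f x) x p.1 * β * g (x, p.1, p.2) i) =
      distortion Q u β θ v x p.1 * β * g (x, p.1, p.2) i := fun p => by
    rw [hρ, ENNReal.toReal_ofReal (Real.exp_pos _).le, smul_eq_mul, ← hx]
    ring
  have hint' : Integrable (fun p : X × Y =>
      distortion (Robust.twist Q (fun x x' => (alpha β θ - alpha β θ') * u x x') f) u β θ'
        (fun x => v x - f x) x p.1 * β * g (x, p.1, p.2) i)
      ((Robust.twist Q (fun x x' => (alpha β θ - alpha β θ') * u x x') f ⊗ₖ κ) x) := by
    rw [hc, integrable_withDensity_iff_integrable_smul' hρm' hρtop]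
    simpa only [heq] using hint
  refine ⟨hint', ?_⟩
  -- The constant `1` carries no distortion, so it is split off; both joint laws have mass one and
  -- it contributes equally.
  rw [integral_sub hint (integrable_const _)] at h0
  rw [integral_sub hint' (integrable_const _)]
  nth_rewrite 1 [hc]
  rw [integral_withDensity_eq_integral_toReal_smul hρm' hρtop]
  simpa only [heq, integral_const, probReal_univ] using h0

end continuationValue

end Robust

end

theorem proposition3p3 {X : Type*} [MeasurableSpace X]
    (Q₀ : Measure X) [IsProbabilityMeasure Q₀]
    (Q : Kernel X X) [IsMarkovKernel Q] (hstat : Kernel.Invariant Q Q₀)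
    (u : X → X → ℝ) (r : ℝ) (hr : 1 < r)
    (hU : Robust.MemOrliczHeart r (Q₀.compProd Q) (fun p : X × X => u p.1 p.2))
    (β₀ θ₀ : ℝ) (hβ₀ : 0 < β₀) (hβ₁ : β₀ < 1) (hθ₀ : 0 < θ₀) :
    ∀ θ : ℝ, 0 < θ → ∃ Qθ : Kernel X X, IsMarkovKernel Qθ ∧
      Robust.SameWorstCase Q₀ r u Qθ β₀ θ Q β₀ θ₀ ∧
      ∀ (Y : Type) [MeasurableSpace Y] (κ : Kernel (X × X) Y) [IsMarkovKernel κ]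
        (d : ℕ) (g : X × X × Y → Fin d → ℝ), Measurable g →
        Robust.MomentRestriction Q₀ r u κ g Q β₀ θ₀ →
        Robust.ObservationallyEquivalent Q₀ r u κ g Qθ β₀ θ Q β₀ θ₀ := by
  intro θ _
  have hr0 : 0 < r := zero_lt_one.trans hr
  have hu : Measurable (Function.uncurry u) := hU.1
  obtain ⟨v, hv⟩ := Robust.exists_isContinuationValue hstat hr hU hβ₀ hβ₁ θ₀
  -- The gap between the two coefficients of `u` is the part of the distortion that the new
  -- benchmark must absorb; its sign is arbitrary.
  obtain ⟨f, hf, hfsol⟩ := Robust.exists_solves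
    (h := fun x x' => (Robust.alpha β₀ θ₀ - Robust.alpha β₀ θ) * u x x') hstat hβ₀ hβ₁ hr
    (hU.const_mul hr0 _)
  exact ⟨Robust.twist Q _ f, Robust.isMarkovKernel_twist (hu.const_mul _) hf.1,
    ⟨_, v, hv.twist hβ₀ hu hf hfsol hr0, hv, hv.worstCase_twist hβ₀ hu hf hfsol hr0⟩,
    fun Y _ κ _ d g _ h => ⟨h.twist hβ₀ hu hf hfsol hr0, h⟩⟩
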